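/- Let $k$ be a field, let $n\ge 1$, and let $(\mathcal C,\mathbb E,\mathfrak s)$ be an $n$-exangulated category in the sense of Herschend–Liu–Nakaoka: $\mathcal C$ is an additive category, $\mathbb E\colon\mathcal C^{\mathrm{op}}\times\mathcal C\to\mathrm{Ab}$ is an additive bifunctor, and $\mathfrak s$ is an exact realization of $\mathbb E$ satisfying (EA1), (EA2) and (EA2$^{\mathrm{op}}$). A distinguished $n$-exangle is a pair $\langle X_\bullet,\delta\rangle$ consisting of an extension $\delta\in\mathbb E(X_{n+1},X_0)$ and a complex $X_0\xrightarrow{\alpha_0}X_1\xrightarrow{\alpha_1}\cdots\xrightarrow{\alpha_n}X_{n+1}$ with $\mathfrak s(\delta)=[X_\bullet]$. Assume that $\mathcal C$ is $k$-linear, Hom-finite (all Hom spaces are finite-dimensional over $k$) and Krull–Schmidt (every object is a finite direct sum of objects with local endomorphism rings), and that $\mathcal C$ is locally finite: for every indecomposable object $X$ there are, up to isomorphism, only finitely many indecomposable objects $Y$ with $\operatorname{Hom}_{\mathcal C}(X,Y)\ne 0$, and only finitely many with $\operatorname{Hom}_{\mathcal C}(Y,X)\neq 0$. An object $P$ is projective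 if for every distinguished $n$-exangle as above every morphism $P\to X_{n+1}$ factors through $\alpha_n$; an object $I$ is injective if for every distinguished $n$-exangle as above every morphism $X_0\to I$ factors through $\alpha_0$. An Auslander–Reiten $n$-exangle is a distinguished $n$-exangle as above such that: - $\alpha_0$ is left almost split, that is, $\alpha_0$ is not a split monomorphism and every morphism $X_0\to Y$ that is not a split monomorphism factors through $\alpha_0$; - $\alpha_n$ is right almost split, that is, $\alpha_n$ is not a split epimorphism and every morphism $Y\to X_{n+1}$ that is not a split epimorphism factors through $\alpha_n$; - if $n\ge 2$, the morphisms $\alpha_1,\dots,\alpha_{n-1}$ lie in the Jacobson radical of $\mathcal C$. Then for every indecomposable non-projective object $X_{n+1}$ of $\mathcal C$ there is an Auslander–Reiten $n$-exangle ending at $X_{n+1}$, and for every indecomposable non-injective object $Y_0$ of $\mathcal C$ there is an Auslander–Reiten $n$-exangle starting at $Y_0$. -/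

import Mathlib

open CategoryTheory CategoryTheory.Limits Opposite

universe w v u t

attribute [local instance] hasBinaryBiproducts_of_finite_biproducts

namespace NExang

section Basics

variable {𝒞 : Type u} [Category.{v} 𝒞] [Preadditive 𝒞]

/-- `E(C, A)`, the group of extensions of a bifunctor `E : 𝒞ᵒᵖ × 𝒞 → Ab`. -/
abbrev Extn (E : 𝒞ᵒᵖ ⥤ 𝒞 ⥤ AddCommGrpCat.{w}) (C A : 𝒞) : Type w :=
  (E.obj (op C)).obj A

/-- `a_* δ` for `a : A ⟶ A'` and `δ ∈ E(C, A)`. -/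
def push {E : 𝒞ᵒᵖ ⥤ 𝒞 ⥤ AddCommGrpCat.{w}} {C A A' : 𝒞} (a : A ⟶ A')
    (δ : Extn E C A) : Extn E C A' :=
  (E.obj (op C)).map a δ

/-- `c^* δ` for `c : C' ⟶ C` and `δ ∈ E(C, A)`. -/
def pull {E : 𝒞ᵒᵖ ⥤ 𝒞 ⥤ AddCommGrpCat.{w}} {C C' A : 𝒞} (c : C' ⟶ C)
    (δ : Extn E C A) : Extn E C' A :=
  (E.map c.op).app A δ

/-- A complex `X₀ ⟶ X₁ ⟶ ⋯ ⟶ X_{n+1}` (a complex in `𝒞` vanishing outside the degrees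
`0, …, n+1`) with end terms `X₀ = A` and `X_{n+1} = C`.  The end terms are identified with `A`
and `C` by chosen isomorphisms, which avoids equalities between objects. -/
structure Cpx (n : ℕ) (A C : 𝒞) where
  /-- The underlying complex. -/
  K : CochainComplex 𝒞 ℕ
  isZero_of_gt : ∀ i, n + 1 < i → IsZero (K.X i)
  /-- The identification of the term in degree `0`. -/
  left : K.X 0 ≅ A
  /-- The identification of the term in degree `n+1`. -/
  right : K.X (n + 1) ≅ C

namespace Cpx

variable {n : ℕ}

/-- The first differential `d₀ : A ⟶ X₁`. -/
def first {A C : 𝒞} (X : Cpx n A C) : A ⟶ X.K.X 1 := X.left.inv ≫ X.K.d 0 1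

/-- The last differential `d_n : X_n ⟶ C`. -/
def last {A C : 𝒞} (X : Cpx n A C) : X.K.X n ⟶ C := X.K.d n (n + 1) ≫ X.right.hom

/-- The chain map `f : X ⟶ Y` is of the form `(a, f₁, …, f_n, c)`. -/
def HasEnds {A C B D : 𝒞} (X : Cpx n A C) (Y : Cpx n B D) (a : A ⟶ B) (c : C ⟶ D)
    (f : X.K ⟶ Y.K) : Prop :=
  f.f 0 ≫ Y.left.hom = X.left.hom ≫ a ∧ f.f (n + 1) ≫ Y.right.hom = X.right.hom ≫ c

/-- Homotopy equivalence of complexes with end terms `A` and `C`, relative to the ends: the two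
chain maps are the identity on `A` and on `C`, and their composites are homotopic to the
identities. -/
def HoEquiv {A C : 𝒞} (X Y : Cpx n A C) : Prop :=
  ∃ (f : X.K ⟶ Y.K) (g : Y.K ⟶ X.K),
    HasEnds X Y (𝟙 A) (𝟙 C) f ∧ HasEnds Y X (𝟙 A) (𝟙 C) g ∧
      Nonempty (Homotopy (f ≫ g) (𝟙 X.K)) ∧ Nonempty (Homotopy (g ≫ f) (𝟙 Y.K))

theorem HasEnds.comp_id {A C : 𝒞} {X Y Z : Cpx n A C} {f : X.K ⟶ Y.K} {g : Y.K ⟶ Z.K}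
    (hf : HasEnds X Y (𝟙 A) (𝟙 C) f) (hg : HasEnds Y Z (𝟙 A) (𝟙 C) g) :
    HasEnds X Z (𝟙 A) (𝟙 C) (f ≫ g) := by
  obtain ⟨h1, h2⟩ := hf
  obtain ⟨h3, h4⟩ := hg
  rw [Category.comp_id] at h1 h2 h3 h4
  refine ⟨?_, ?_⟩ <;> rw [Category.comp_id, HomologicalComplex.comp_f, Category.assoc]
  · rw [h3, h1]
  · rw [h4, h2]

/-- Relative homotopy equivalence is an equivalence relation. -/
instance hoSetoid (n : ℕ) (A C : 𝒞) : Setoid (Cpx n A C) where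
  r := HoEquiv
  iseqv :=
    { refl := fun X => ⟨𝟙 _, 𝟙 _, ⟨by simp, by simp⟩, ⟨by simp, by simp⟩,
        ⟨Homotopy.ofEq (by simp)⟩, ⟨Homotopy.ofEq (by simp)⟩⟩
      symm := fun ⟨f, g, hf, hg, h1, h2⟩ => ⟨g, f, hg, hf, h2, h1⟩
      trans := by
        rintro X Y Z ⟨f, g, hf, hg, ⟨h1⟩, ⟨h2⟩⟩ ⟨f', g', hf', hg', ⟨h1'⟩, ⟨h2'⟩⟩
        refine ⟨f ≫ f', g' ≫ g, hf.comp_id hf', hg'.comp_id hg, ⟨?_⟩, ⟨?_⟩⟩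
        · exact (Homotopy.ofEq (by simp)).trans
            ((((h1'.compRight g).compLeft f).trans (Homotopy.ofEq (by simp))).trans h1)
        · exact (Homotopy.ofEq (by simp)).trans
            ((((h2.compRight f').compLeft g').trans (Homotopy.ofEq (by simp))).trans h2') }

/-- `⟨X, δ⟩` is an `n`-exangle: `(d₀)_* δ = 0`, `(d_n)^* δ = 0`, and for every object `Z` the
sequences
`𝒞(Z, X₀) → ⋯ → 𝒞(Z, X_{n+1}) → E(Z, A)` and `𝒞(X_{n+1}, Z) → ⋯ → 𝒞(X₀, Z) → E(C, Z)`
are exact. -/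
structure IsExangle {E : 𝒞ᵒᵖ ⥤ 𝒞 ⥤ AddCommGrpCat.{w}} {A C : 𝒞} (X : Cpx n A C)
    (δ : Extn E C A) : Prop where
  push_first : push X.first δ = 0
  pull_last : pull X.last δ = 0
  exact_to : ∀ (i : ℕ), i < n → ∀ Z : 𝒞, Function.Exact
    (fun f : Z ⟶ X.K.X i => f ≫ X.K.d i (i + 1))
    (fun f : Z ⟶ X.K.X (i + 1) => f ≫ X.K.d (i + 1) (i + 2))
  exact_to_last : ∀ Z : 𝒞, Function.Exact
    (fun f : Z ⟶ X.K.X n => f ≫ X.last) (fun f : Z ⟶ C => pull f δ)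
  exact_from : ∀ (i : ℕ), i < n → ∀ Z : 𝒞, Function.Exact
    (fun f : X.K.X (i + 2) ⟶ Z => X.K.d (i + 1) (i + 2) ≫ f)
    (fun f : X.K.X (i + 1) ⟶ Z => X.K.d i (i + 1) ≫ f)
  exact_from_first : ∀ Z : 𝒞, Function.Exact
    (fun f : X.K.X 1 ⟶ Z => X.first ≫ f) (fun f : A ⟶ Z => push f δ)

/-- `X` is of the form `A = A ⟶ 0 ⟶ ⋯ ⟶ 0` (up to isomorphism relative to the ends). -/
def IsTrivialLeft {A C : 𝒞} (X : Cpx n A C) : Prop :=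
  IsIso (X.K.d 0 1) ∧ ∀ i, 2 ≤ i → IsZero (X.K.X i)

/-- `X` is of the form `0 ⟶ ⋯ ⟶ 0 ⟶ C = C` (up to isomorphism relative to the ends). -/
def IsTrivialRight {A C : 𝒞} (X : Cpx n A C) : Prop :=
  IsIso (X.K.d n (n + 1)) ∧ ∀ i, i < n → IsZero (X.K.X i)

variable [HasBinaryBiproducts 𝒞]

/-- `M` is the mapping cone
`X₁ ⟶ X₂ ⊞ Y₁ ⟶ X₃ ⊞ Y₂ ⟶ ⋯ ⟶ X_{n+1} ⊞ Y_n ⟶ Y_{n+1} = D`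
of a chain map `f : X ⟶ Y` with `f₀ = 𝟙 A`; its differentials are the matrices
`(-d^X₁, f₁)`, then `(-d^X_{i+1}, 0; f_{i+1}, d^Y_i)` for `1 ≤ i ≤ n-1`, and `(f_{n+1}, d^Y_n)`. -/
def IsCone {A C D : 𝒞} (X : Cpx n A C) (Y : Cpx n A D) (f : X.K ⟶ Y.K)
    (M : Cpx n (X.K.X 1) D) : Prop :=
  ∃ φ : ∀ i, 1 ≤ i → i ≤ n → (M.K.X i ≅ X.K.X (i + 1) ⊞ Y.K.X i),
    (∀ h : 1 ≤ n, M.first ≫ (φ 1 le_rfl h).hom = biprod.lift (-X.K.d 1 2) (f.f 1)) ∧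
    (∀ (i : ℕ) (h1 : 1 ≤ i) (h2 : i + 1 ≤ n),
      (φ i h1 (by omega)).inv ≫ M.K.d i (i + 1) ≫ (φ (i + 1) (by omega) h2).hom =
        Biprod.ofComponents (-X.K.d (i + 1) (i + 2)) (f.f (i + 1)) 0 (Y.K.d i (i + 1))) ∧
    (∀ h : 1 ≤ n, (φ n h le_rfl).inv ≫ M.last =
      biprod.desc (f.f (n + 1) ≫ Y.right.hom) Y.last)

/-- `N` is the mapping cocone
`A = X₀ ⟶ Y₀ ⊞ X₁ ⟶ Y₁ ⊞ X₂ ⟶ ⋯ ⟶ Y_{n-1} ⊞ X_n ⟶ Y_n`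
of a chain map `f : X ⟶ Y` with `f_{n+1} = 𝟙 C`.  This is the mapping cone in the opposite
category: its differentials are the matrices `(f₀, d^X₀)`, then
`(-d^Y_i, f_{i+1}; 0, d^X_{i+1})` for `0 ≤ i ≤ n-2`, and `(-d^Y_{n-1}, f_n)`. -/
def IsCocone {A B C : 𝒞} (X : Cpx n A C) (Y : Cpx n B C) (f : X.K ⟶ Y.K)
    (N : Cpx n A (Y.K.X n)) : Prop :=
  ∃ ψ : ∀ i j, i + 1 = j → j ≤ n → (N.K.X j ≅ Y.K.X i ⊞ X.K.X j),
    (∀ h : 1 ≤ n, N.first ≫ (ψ 0 1 rfl h).hom =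
      biprod.lift (X.left.inv ≫ f.f 0) X.first) ∧
    (∀ (i : ℕ) (h : i + 2 ≤ n),
      (ψ i (i + 1) rfl (by omega)).inv ≫ N.K.d (i + 1) (i + 2) ≫ (ψ (i + 1) (i + 2) rfl h).hom =
        Biprod.ofComponents (-Y.K.d i (i + 1)) 0 (f.f (i + 1)) (X.K.d (i + 1) (i + 2))) ∧
    (∀ (i : ℕ) (h : i + 1 = n), (ψ i n h le_rfl).inv ≫ N.last =
      biprod.desc (-Y.K.d i n) (f.f n))

end Cpx

end Basics

section Exangulated

variable (n : ℕ) (𝒞 : Type u) [Category.{v} 𝒞] [Preadditive 𝒞]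

/-- An additive bifunctor `E : 𝒞ᵒᵖ × 𝒞 → Ab` together with a correspondence `s` that assigns to
every extension `δ ∈ E(C, A)` a homotopy equivalence class of complexes with end terms `A`
and `C`. -/
structure PreExangulated where
  /-- The bifunctor of extensions. -/
  E : 𝒞ᵒᵖ ⥤ 𝒞 ⥤ AddCommGrpCat.{w}
  additive_left : E.Additive
  additive_right : ∀ C : 𝒞ᵒᵖ, (E.obj C).Additive
  /-- The correspondence assigning homotopy classes to extensions. -/
  s : ∀ {A C : 𝒞}, Extn E C A → Quotient (Cpx.hoSetoid n A C)

variable {n 𝒞}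

namespace PreExangulated

variable (S : PreExangulated.{w} n 𝒞)

/-- `X` realizes `δ`, that is `s(δ) = [X]`.  For an exact realization this says that `⟨X, δ⟩` is
a distinguished `n`-exangle. -/
def Dist {A C : 𝒞} (X : Cpx n A C) (δ : Extn S.E C A) : Prop :=
  S.s δ = Quotient.mk (Cpx.hoSetoid n A C) X

/-- `f` is the first map of some conflation. -/
def Inflation {A B : 𝒞} (f : A ⟶ B) : Prop :=
  ∃ (C : 𝒞) (δ : Extn S.E C A) (X : Cpx n A C) (e : X.K.X 1 ≅ B),
    S.Dist X δ ∧ X.first ≫ e.hom = f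

/-- `g` is the last map of some conflation. -/
def Deflation {B C : 𝒞} (g : B ⟶ C) : Prop :=
  ∃ (A : 𝒞) (δ : Extn S.E C A) (X : Cpx n A C) (e : X.K.X n ≅ B),
    S.Dist X δ ∧ e.inv ≫ X.last = g

/-- An object `P` is projective if every `c : P ⟶ A_{n+1}` factors through the last map of every
distinguished `n`-exangle ending at `A_{n+1}`. -/
def Projective (P : 𝒞) : Prop :=
  ∀ ⦃A C : 𝒞⦄ (X : Cpx n A C) (δ : Extn S.E C A), S.Dist X δ →
    ∀ c : P ⟶ C, ∃ b : P ⟶ X.K.X n, b ≫ X.last = c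

/-- An object `I` is injective if every `a : A₀ ⟶ I` factors through the first map of every
distinguished `n`-exangle starting at `A₀`. -/
def Injective (I : 𝒞) : Prop :=
  ∀ ⦃A C : 𝒞⦄ (X : Cpx n A C) (δ : Extn S.E C A), S.Dist X δ →
    ∀ a : A ⟶ I, ∃ b : X.K.X 1 ⟶ I, X.first ≫ b = a

end PreExangulated

/-- The axioms of an `n`-exangulated category `(𝒞, E, s)`. -/
structure IsExangulated [HasBinaryBiproducts 𝒞] (S : PreExangulated.{w} n 𝒞) : Prop where
  /-- (R0) Every morphism of extensions lifts to a chain map. -/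
  lift : ∀ {A C B D : 𝒞} (δ : Extn S.E C A) (ρ : Extn S.E D B) (X : Cpx n A C) (Y : Cpx n B D),
    S.Dist X δ → S.Dist Y ρ → ∀ (a : A ⟶ B) (c : C ⟶ D), push a δ = pull c ρ →
      ∃ f : X.K ⟶ Y.K, Cpx.HasEnds X Y a c f
  /-- (R1) If `X` realizes `δ`, then `⟨X, δ⟩` is an `n`-exangle. -/
  isExangle : ∀ {A C : 𝒞} (δ : Extn S.E C A) (X : Cpx n A C), S.Dist X δ → X.IsExangle δ
  /-- (R2) `s(0) = [A = A ⟶ 0 ⟶ ⋯ ⟶ 0]` for `0 ∈ E(0, A)`. -/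
  trivial_left : ∀ {A Z : 𝒞}, IsZero Z → ∀ X : Cpx n A Z, X.IsTrivialLeft →
    S.Dist X (0 : Extn S.E Z A)
  /-- (R2) `s(0) = [0 ⟶ ⋯ ⟶ 0 ⟶ A = A]` for `0 ∈ E(A, 0)`. -/
  trivial_right : ∀ {A Z : 𝒞}, IsZero Z → ∀ X : Cpx n Z A, X.IsTrivialRight →
    S.Dist X (0 : Extn S.E A Z)
  /-- (EA1) Inflations are closed under composition. -/
  inflation_comp : ∀ {A B C : 𝒞} (f : A ⟶ B) (g : B ⟶ C),
    S.Inflation f → S.Inflation g → S.Inflation (f ≫ g)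
  /-- (EA1) Deflations are closed under composition. -/
  deflation_comp : ∀ {A B C : 𝒞} (f : A ⟶ B) (g : B ⟶ C),
    S.Deflation f → S.Deflation g → S.Deflation (f ≫ g)
  /-- (EA2) `(𝟙 A, c)` has a good lift. -/
  good_lift : ∀ {A C D : 𝒞} (ρ : Extn S.E D A) (c : C ⟶ D) (X : Cpx n A C) (Y : Cpx n A D),
    S.Dist X (pull c ρ) → S.Dist Y ρ →
      ∃ f : X.K ⟶ Y.K, Cpx.HasEnds X Y (𝟙 A) c f ∧
        ∃ M : Cpx n (X.K.X 1) D, Cpx.IsCone X Y f M ∧ S.Dist M (push X.first ρ)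
  /-- (EA2ᵒᵖ) `(a, 𝟙 C)` has a good lift. -/
  good_lift_op : ∀ {A B C : 𝒞} (ρ : Extn S.E C A) (a : A ⟶ B) (X : Cpx n A C) (Y : Cpx n B C),
    S.Dist X ρ → S.Dist Y (push a ρ) →
      ∃ f : X.K ⟶ Y.K, Cpx.HasEnds X Y a (𝟙 C) f ∧
        ∃ N : Cpx n A (Y.K.X n), Cpx.IsCocone X Y f N ∧ S.Dist N (pull Y.last ρ)

end Exangulated

section AuslanderReiten

variable {𝒞 : Type u} [Category.{v} 𝒞] [Preadditive 𝒞]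

/-- The Jacobson radical of a preadditive category: `f ∈ rad(X, Y)` if `1 - g ∘ f` is invertible
for every `g : Y ⟶ X`. -/
def InRad {X Y : 𝒞} (f : X ⟶ Y) : Prop :=
  ∀ g : Y ⟶ X, IsIso (𝟙 X - f ≫ g)

/-- `f : A ⟶ B` is not a split monomorphism, and every morphism out of `A` that is not a split
monomorphism factors through `f`. -/
def LeftAlmostSplit {A B : 𝒞} (f : A ⟶ B) : Prop :=
  ¬ IsSplitMono f ∧ ∀ ⦃Y : 𝒞⦄ (g : A ⟶ Y), ¬ IsSplitMono g → ∃ h : B ⟶ Y, f ≫ h = g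

/-- `f : B ⟶ C` is not a split epimorphism, and every morphism into `C` that is not a split
epimorphism factors through `f`. -/
def RightAlmostSplit {B C : 𝒞} (f : B ⟶ C) : Prop :=
  ¬ IsSplitEpi f ∧ ∀ ⦃Y : 𝒞⦄ (g : Y ⟶ C), ¬ IsSplitEpi g → ∃ h : Y ⟶ B, h ≫ f = g

/-- `⟨X, δ⟩` is an Auslander–Reiten `n`-exangle. -/
structure IsARExangle {n : ℕ} (S : PreExangulated.{w} n 𝒞) {A C : 𝒞} (X : Cpx n A C)
    (δ : Extn S.E C A) : Prop where
  dist : S.Dist X δ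
  left : LeftAlmostSplit X.first
  right : RightAlmostSplit X.last
  rad : ∀ i, 1 ≤ i → i + 1 ≤ n → InRad (X.K.d i (i + 1))

variable (𝒞)

/-- Every object is a finite direct sum of objects with local endomorphism rings. -/
def IsKrullSchmidt [HasFiniteBiproducts 𝒞] : Prop :=
  ∀ X : 𝒞, ∃ (m : ℕ) (Y : Fin m → 𝒞),
    (∀ i, IsLocalRing (End (Y i))) ∧ Nonempty (X ≅ ⨁ Y)

/-- For every indecomposable `X` there are, up to isomorphism, only finitely many indecomposables
`Y` with `Hom(X, Y) ≠ 0` and only finitely many with `Hom(Y, X) ≠ 0`. -/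
def IsLocallyFinite [HasBinaryBiproducts 𝒞] : Prop :=
  ∀ X : 𝒞, Indecomposable X →
    (Quotient.mk (isIsomorphicSetoid 𝒞) '' {Y | Indecomposable Y ∧ ∃ f : X ⟶ Y, f ≠ 0}).Finite ∧
    (Quotient.mk (isIsomorphicSetoid 𝒞) '' {Y | Indecomposable Y ∧ ∃ f : Y ⟶ X, f ≠ 0}).Finite

end AuslanderReiten

end NExang

/-! Call a nonzero `δ` in `E(C, A)` a right socle element if its pullback along every morphism into
`C` that is not a split epimorphism vanishes; left socle elements are dual. Exactness of a
realization of `δ` at its last (first) map turns the right (left) socle property into right (left)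
almost splitness, so a nonzero extension with both properties suffices.

The tool is one further exact term, extracted from (EA2): if `X` realizes `ρ`, an extension killed
by pushing along `X.first` is a pullback of `ρ` (`exists_pull_eq`; dually `exists_push_eq`). Its
typical use: if `f` is not a split epimorphism into `C`, with `End C` local, and `X` realizes the
pullback of `δ` along `f`, then `X.first` cannot kill `δ`. Otherwise `δ` would equal its own
pullback along some `g ≫ f`, while `𝟙 - g ≫ f` is invertible, forcing `δ = 0`.

Existence of a right socle element (`exists_rightSocle`): local finiteness gives one object `T`
whose maps to `C` detect every nonzero pullback. Take a nonzero extension, with first term free to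
vary, whose annihilator in the finite-dimensional space `T ⟶ C` is maximal. A nonzero pullback along
such an `f` would allow a push along `X.first` that stays nonzero and strictly enlarges the
annihilator.

A Krull–Schmidt decomposition then makes the other end term local, and the same tool upgrades the
one-sided property to both sides (`leftSocle_of_rightSocle`). Radical inner differentials come from
stripping off contractible summands `W = W`, which preserves the relative homotopy class
(`Cpx.exists_radical`). -/

namespace NExang

/-! ### Local endomorphism rings and Krull–Schmidt decompositions -/

section LocalObjects

variable {𝒞 : Type u} [Category.{v} 𝒞] [Preadditive 𝒞]

/-- An object with local endomorphism ring, expressed without reference to the ring structure. -/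
def LocalObject (X : 𝒞) : Prop :=
  ¬ IsZero X ∧ ∀ f : X ⟶ X, IsIso f ∨ IsIso (𝟙 X - f)

theorem isZero_of_split_zero {X : 𝒞} (h : 𝟙 X = 0) : IsZero X :=
  (IsZero.iff_id_eq_zero X).2 h

theorem LocalObject.of_isLocalRing {X : 𝒞} (h : IsLocalRing (End X)) : LocalObject X := by
  refine ⟨fun hz => ?_, fun f => ?_⟩
  · exact one_ne_zero (α := End X) (hz.eq_of_src _ _)
  · have := IsLocalRing.isUnit_or_isUnit_of_add_one (R := End X) (a := f) (b := 𝟙 X - f)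
      (by change f + (𝟙 X - f) = 𝟙 X; abel)
    simpa only [isUnit_iff_isIso] using this

theorem LocalObject.of_iso {X Y : 𝒞} (e : X ≅ Y) (h : LocalObject X) : LocalObject Y := by
  refine ⟨fun hz => h.1 (hz.of_iso e), fun f => ?_⟩
  have key : ∀ g : Y ⟶ Y, IsIso (e.hom ≫ g ≫ e.inv) → IsIso g := by
    intro g hg
    have : g = e.inv ≫ (e.hom ≫ g ≫ e.inv) ≫ e.hom := by simp
    rw [this]; infer_instance
  rcases h.2 (e.hom ≫ f ≫ e.inv) with h1 | h1
  · exact Or.inl (key _ h1)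
  · refine Or.inr (key _ ?_)
    simpa [Preadditive.comp_sub, Preadditive.sub_comp] using h1

/-- An endomorphism of a local object that factors as `f ≫ g` with `f` not a split monomorphism
is a radical endomorphism. -/
theorem LocalObject.isIso_sub_of_not_splitMono {X Y : 𝒞} (h : LocalObject X) (f : X ⟶ Y)
    (hf : ¬ IsSplitMono f) (g : Y ⟶ X) : IsIso (𝟙 X - f ≫ g) := by
  refine (h.2 (f ≫ g)).resolve_left fun hi => hf ?_
  exact IsSplitMono.mk' ⟨g ≫ inv (f ≫ g), by rw [← Category.assoc, IsIso.hom_inv_id]⟩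

theorem LocalObject.isIso_sub_of_not_splitEpi {X Y : 𝒞} (h : LocalObject X) (f : Y ⟶ X)
    (hf : ¬ IsSplitEpi f) (g : X ⟶ Y) : IsIso (𝟙 X - g ≫ f) := by
  refine (h.2 (g ≫ f)).resolve_left fun hi => hf ?_
  exact IsSplitEpi.mk' ⟨inv (g ≫ f) ≫ g, by rw [Category.assoc, IsIso.inv_hom_id]⟩

/-- A split monomorphism from a nonzero object to a local object is invertible. -/
theorem LocalObject.isIso_of_retraction {X Y : 𝒞} (hX : ¬ IsZero X) (hY : LocalObject Y)
    (f : X ⟶ Y) (g : Y ⟶ X) (h : f ≫ g = 𝟙 X) : IsIso f := by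
  rcases hY.2 (g ≫ f) with h1 | h1
  -- `g ≫ f` is idempotent, so it is the identity once it is invertible.
  · have : (g ≫ f) ≫ (g ≫ f) = (g ≫ f) ≫ 𝟙 Y := by
      rw [Category.assoc, reassoc_of% h, Category.comp_id]
    exact ⟨g, h, (cancel_epi _).1 this⟩
  · exfalso
    have h2 : f ≫ (𝟙 Y - g ≫ f) = 0 ≫ (𝟙 Y - g ≫ f) := by
      rw [Preadditive.comp_sub, reassoc_of% h, Category.comp_id, sub_self, zero_comp]
    have h3 : f = 0 := (cancel_mono _).1 h2
    exact hX (isZero_of_split_zero (by rw [← h, h3, zero_comp]))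

theorem LocalObject.indecomposable [HasBinaryBiproducts 𝒞] {X : 𝒞} (h : LocalObject X) :
    Indecomposable X := by
  refine ⟨h.1, fun Y Z e => ?_⟩
  by_contra! hc
  have hY : (biprod.inl ≫ e.inv) ≫ (e.hom ≫ biprod.fst) = 𝟙 Y := by simp
  have := LocalObject.isIso_of_retraction hc.1 h _ _ hY
  have h0 : (biprod.inl ≫ e.inv) ≫ e.hom ≫ biprod.snd = (biprod.inl ≫ e.inv) ≫ 0 := by simp
  have h1 : e.hom ≫ biprod.snd = 0 := (cancel_epi _).1 h0
  refine hc.2 (isZero_of_split_zero ?_)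
  calc 𝟙 Z = biprod.inr ≫ e.inv ≫ e.hom ≫ biprod.snd := by simp
    _ = 0 := by rw [h1, comp_zero, comp_zero]

variable [HasFiniteBiproducts 𝒞]

/-- A decomposition of every object into local objects, in terms of inclusions and projections,
together with complements of the summands. -/
theorem IsKrullSchmidt.exists_decomposition (h : IsKrullSchmidt 𝒞) (X : 𝒞) :
    ∃ (m : ℕ) (Y : Fin m → 𝒞) (ι : ∀ i, Y i ⟶ X) (π : ∀ i, X ⟶ Y i),
      (∀ i, LocalObject (Y i)) ∧ ∑ i, π i ≫ ι i = 𝟙 X ∧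
      ∀ i, ι i ≫ π i = 𝟙 _ ∧ ∃ (P : 𝒞) (s : P ⟶ X) (r : X ⟶ P),
        s ≫ r = 𝟙 P ∧ r ≫ s = 𝟙 X - π i ≫ ι i := by
  classical
  obtain ⟨m, Y, hY, ⟨e⟩⟩ := h X
  refine ⟨m, Y, fun i => biproduct.ι Y i ≫ e.inv, fun i => e.hom ≫ biproduct.π Y i,
    fun i => .of_isLocalRing (hY i), ?_, fun i => ⟨by simp, ?_⟩⟩
  · calc _ = e.hom ≫ (∑ i, biproduct.π Y i ≫ biproduct.ι Y i) ≫ e.inv := by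
          simp only [Category.assoc, Preadditive.sum_comp, Preadditive.comp_sum]
      _ = 𝟙 X := by rw [biproduct.total]; simp
  · refine ⟨⨁ Subtype.restrict (fun j => j ≠ i) Y,
      biproduct.fromSubtype Y _ ≫ e.inv, e.hom ≫ biproduct.toSubtype Y _, ?_, ?_⟩
    · simp only [Category.assoc, Iso.inv_hom_id_assoc]
      exact biproduct.fromSubtype_toSubtype Y _
    · have : biproduct.toSubtype Y (fun j => j ≠ i) ≫ biproduct.fromSubtype Y (fun j => j ≠ i) =
          𝟙 _ - biproduct.π Y i ≫ biproduct.ι Y i := by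
        rw [biproduct.toSubtype_fromSubtype]
        refine biproduct.hom_ext' _ _ fun a => ?_
        rw [biproduct.ι_map, Preadditive.comp_sub, Category.comp_id]
        by_cases ha : a = i
        · subst ha
          rw [if_neg (by simp), zero_comp, biproduct.ι_π_self_assoc, sub_self]
        · rw [if_pos ha, Category.id_comp, biproduct.ι_π_ne_assoc _ ha, zero_comp, sub_zero]
      rw [Category.assoc, reassoc_of% this]
      simp [Preadditive.sub_comp, Preadditive.comp_sub]

/-- Some local summand `Y i` exists because the object is nonzero; indecomposability kills its
complement `P`, so `ι i` is an isomorphism. -/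
theorem IsKrullSchmidt.localObject (h : IsKrullSchmidt 𝒞) {X : 𝒞} (hX : Indecomposable X) :
    LocalObject X := by
  obtain ⟨m, Y, ι, π, hY, htot, hd⟩ := h.exists_decomposition X
  have hm : ∃ i : Fin m, True := by
    by_contra! hc
    refine hX.1 (isZero_of_split_zero ?_)
    rw [← htot]
    exact Finset.sum_eq_zero fun i _ => (hc i).elim
  obtain ⟨i, -⟩ := hm
  obtain ⟨h1, P, s, r, hsr, hrs⟩ := hd i
  have hs : s ≫ π i = 0 := by
    have : s ≫ r ≫ s ≫ π i = 0 := by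
      rw [reassoc_of% hrs, Preadditive.sub_comp, Category.assoc, h1]; simp
    rwa [reassoc_of% hsr] at this
  have hr : ι i ≫ r = 0 := by
    have : (ι i ≫ r ≫ s) ≫ r = 0 := by
      rw [hrs, Preadditive.comp_sub, reassoc_of% h1]; simp
    simpa [hsr] using this
  let e : X ≅ Y i ⊞ P :=
    { hom := biprod.lift (π i) r
      inv := biprod.desc (ι i) s
      hom_inv_id := by rw [biprod.lift_desc, hrs]; abel
      inv_hom_id := by ext <;> simp [h1, hs, hr, hsr] }
  have hP := (hX.2 _ _ e).resolve_left (hY i).1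
  refine (hY i).of_iso ⟨ι i, π i, h1, ?_⟩
  have : r ≫ s = 0 := by rw [hP.eq_of_tgt r 0, zero_comp]
  rw [this] at hrs
  exact (sub_eq_zero.1 hrs.symm).symm

end LocalObjects

/-! ### The Jacobson radical -/

section Radical

variable {𝒞 : Type u} [Category.{v} 𝒞] [Preadditive 𝒞]

/-- If `c` inverts `𝟙 Y - b ≫ a`, then `𝟙 X + a ≫ c ≫ b` inverts `𝟙 X - a ≫ b`. -/
theorem isIso_one_sub_swap {X Y : 𝒞} (a : X ⟶ Y) (b : Y ⟶ X) (h : IsIso (𝟙 Y - b ≫ a)) :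
    IsIso (𝟙 X - a ≫ b) := by
  obtain ⟨c, h1, h2⟩ := h
  rw [Preadditive.sub_comp, Category.id_comp, Category.assoc] at h1
  rw [Preadditive.comp_sub, Category.comp_id] at h2
  refine ⟨𝟙 X + a ≫ c ≫ b, ?_, ?_⟩
  · have : a ≫ (c - b ≫ a ≫ c) ≫ b = a ≫ b := by rw [h1]; simp
    simp only [Preadditive.sub_comp, Preadditive.comp_sub, Preadditive.comp_add, Category.assoc,
      Category.id_comp, Category.comp_id] at this ⊢
    rw [← this]; abel
  · have : a ≫ (c - c ≫ b ≫ a) ≫ b = a ≫ b := by rw [h2]; simp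
    simp only [Preadditive.sub_comp, Preadditive.comp_sub, Preadditive.add_comp, Category.assoc,
      Category.id_comp, Category.comp_id] at this ⊢
    rw [sub_eq_iff_eq_add] at this
    rw [this]; abel

theorem InRad.comp {W X Y Z : 𝒞} {f : X ⟶ Y} (h : InRad f) (a : W ⟶ X) (b : Y ⟶ Z) :
    InRad (a ≫ f ≫ b) := by
  intro g
  rw [Category.assoc]
  refine isIso_one_sub_swap a _ ?_
  simpa using h (b ≫ g ≫ a)

theorem InRad.add {X Y : 𝒞} {f g : X ⟶ Y} (hf : InRad f) (hg : InRad g) : InRad (f + g) := by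
  intro b
  have := hf b
  have h2 : IsIso (𝟙 X - (inv (𝟙 X - f ≫ b) ≫ g) ≫ b) := by
    simpa using hg.comp (inv (𝟙 X - f ≫ b)) (𝟙 _) b
  have : 𝟙 X - (f + g) ≫ b = (𝟙 X - f ≫ b) ≫ (𝟙 X - (inv (𝟙 X - f ≫ b) ≫ g) ≫ b) := by
    rw [Preadditive.comp_sub, Category.comp_id, Category.assoc, IsIso.hom_inv_id_assoc,
      Preadditive.add_comp]
    abel
  rw [this]; infer_instance

theorem inRad_zero (X Y : 𝒞) : InRad (0 : X ⟶ Y) := fun g => by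
  rw [zero_comp, sub_zero]; infer_instance

theorem InRad.sum {X Y : 𝒞} {α : Type*} (s : Finset α) (f : α → (X ⟶ Y))
    (h : ∀ a ∈ s, InRad (f a)) : InRad (∑ a ∈ s, f a) :=
  Finset.sum_induction f InRad (fun _ _ => InRad.add) (inRad_zero X Y) h

theorem inRad_of_not_isIso {X Y : 𝒞} (hX : LocalObject X) (hY : LocalObject Y) (f : X ⟶ Y)
    (hf : ¬ IsIso f) : InRad f := fun g =>
  hX.isIso_sub_of_not_splitMono f (fun ⟨⟨s⟩⟩ =>
    hf (LocalObject.isIso_of_retraction hX.1 hY f s.retraction s.id)) g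

variable [HasFiniteBiproducts 𝒞]

/-- A morphism outside the radical of a Krull–Schmidt category induces an isomorphism between
nonzero direct summands of its source and target, and these summands have complements. -/
theorem IsKrullSchmidt.exists_summand_of_not_inRad (h : IsKrullSchmidt 𝒞) {X Z : 𝒞} (d : X ⟶ Z)
    (hd : ¬ InRad d) : ∃ (W : 𝒞) (u : W ⟶ X) (p : Z ⟶ W), ¬ IsZero W ∧ u ≫ d ≫ p = 𝟙 W ∧
      (∃ (P : 𝒞) (s : P ⟶ X) (r : X ⟶ P), s ≫ r = 𝟙 P ∧ r ≫ s = 𝟙 X - (d ≫ p) ≫ u) ∧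
      (∃ (P : 𝒞) (s : P ⟶ Z) (r : Z ⟶ P), s ≫ r = 𝟙 P ∧ r ≫ s = 𝟙 Z - p ≫ u ≫ d) := by
  obtain ⟨m, Y, ι, π, hY, htot, hdec⟩ := h.exists_decomposition X
  obtain ⟨m', Y', ι', π', hY', htot', hdec'⟩ := h.exists_decomposition Z
  -- If no matrix entry between local summands were invertible, every entry, hence `d`, would be
  -- radical.
  have : ∃ i j, IsIso (ι i ≫ d ≫ π' j) := by
    by_contra! hc
    apply hd
    have : d = ∑ i, ∑ j, π i ≫ (ι i ≫ d ≫ π' j) ≫ ι' j := by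
      calc d = (∑ i, π i ≫ ι i) ≫ d ≫ ∑ j, π' j ≫ ι' j := by rw [htot, htot']; simp
        _ = _ := by
          simp only [Preadditive.sum_comp, Preadditive.comp_sum, Category.assoc]
          exact Finset.sum_comm
    rw [this]
    exact InRad.sum _ _ fun i _ => InRad.sum _ _ fun j _ =>
      (inRad_of_not_isIso (hY i) (hY' j) _ (hc i j)).comp _ _
  obtain ⟨i, j, hij⟩ := this
  obtain ⟨h1, P, s, r, hsr, hrs⟩ := hdec i
  obtain ⟨h1', P', s', r', hsr', hrs'⟩ := hdec' j
  have hid : ι i ≫ d ≫ π' j ≫ inv (ι i ≫ d ≫ π' j) = 𝟙 _ := by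
    have := IsIso.hom_inv_id (ι i ≫ d ≫ π' j)
    simpa only [Category.assoc] using this
  have hid' : inv (ι i ≫ d ≫ π' j) ≫ ι i ≫ d ≫ π' j = 𝟙 _ := IsIso.inv_hom_id _
  generalize inv (ι i ≫ d ≫ π' j) = c at hid hid'
  have hr : ι i ≫ r = 0 := by
    have : (ι i ≫ r ≫ s) ≫ r = 0 := by
      rw [hrs, Preadditive.comp_sub, reassoc_of% h1]; simp
    simpa [hsr] using this
  have hs' : s' ≫ π' j = 0 := by
    have : s' ≫ r' ≫ s' ≫ π' j = 0 := by
      rw [reassoc_of% hrs', Preadditive.sub_comp, Category.assoc, h1']; simp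
    rwa [reassoc_of% hsr'] at this
  -- The new idempotent on `X` has the same image as `π i ≫ ι i` but another kernel, so the
  -- complement keeps `r` and corrects `s`. On `Z` the kernel is kept and the image changes, so `s'`
  -- stays and `r'` is corrected.
  refine ⟨Y i, ι i, π' j ≫ c, (hY i).1, hid,
    ⟨P, s ≫ (𝟙 X - (d ≫ π' j ≫ c) ≫ ι i), r, ?_, ?_⟩,
    ⟨P', s', (𝟙 Z - (π' j ≫ c) ≫ ι i ≫ d) ≫ r', ?_, ?_⟩⟩
  · simp [Preadditive.sub_comp, Preadditive.comp_sub, hr, hsr]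
  · rw [reassoc_of% hrs]
    simp [Preadditive.sub_comp, Preadditive.comp_sub, reassoc_of% hid]
  · simp [Preadditive.sub_comp, Preadditive.comp_sub, reassoc_of% hs', hsr']
  · rw [Category.assoc, hrs']
    simp [Preadditive.sub_comp, Preadditive.comp_sub, reassoc_of% hid']

end Radical

/-! ### Finitely many isomorphism classes as summands of one object -/

section Generators

variable {𝒞 : Type u} [Category.{v} 𝒞] [Preadditive 𝒞] [HasFiniteBiproducts 𝒞]

/-- A finite set of isomorphism classes of objects is contained in the set of direct summands of
a single object. -/
theorem exists_object_with_summands (p : 𝒞 → Prop)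
    (h : (Quotient.mk (isIsomorphicSetoid 𝒞) '' {Y | p Y}).Finite) :
    ∃ T : 𝒞, ∀ Y, p Y → ∃ (i : Y ⟶ T) (r : T ⟶ Y), i ≫ r = 𝟙 Y := by
  classical
  obtain ⟨m, e, -, he⟩ := h.fin_param
  refine ⟨⨁ fun i => (e i).out, fun Y hY => ?_⟩
  obtain ⟨i, hi⟩ : Quotient.mk (isIsomorphicSetoid 𝒞) Y ∈ Set.range e := he ▸ ⟨Y, hY, rfl⟩
  have hr : (isIsomorphicSetoid 𝒞).r (e i).out Y := Quotient.exact (by rw [Quotient.out_eq, hi])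
  obtain ⟨f⟩ : IsIsomorphic (e i).out Y := hr
  exact ⟨f.inv ≫ biproduct.ι (fun i => (e i).out) i, biproduct.π (fun i => (e i).out) i ≫ f.hom,
    by simp⟩

end Generators

/-! ### Minimal representatives of relative homotopy classes -/

section Minimal

variable {𝒞 : Type u} [Category.{v} 𝒞] [Preadditive 𝒞]

/-- The complex obtained by splitting, in every degree, an idempotent chain map. -/
def splitComplex {K : CochainComplex 𝒞 ℕ} (φ : K ⟶ K) (Y : ℕ → 𝒞) (s : ∀ j, Y j ⟶ K.X j)
    (r : ∀ j, K.X j ⟶ Y j) (hrs : ∀ j, r j ≫ s j = φ.f j) : CochainComplex 𝒞 ℕ where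
  X := Y
  d i j := s i ≫ K.d i j ≫ r j
  shape i j h := by rw [K.shape i j h, zero_comp, comp_zero]
  d_comp_d' i j l _ _ := by
    rw [Category.assoc, Category.assoc, reassoc_of% (hrs j), φ.comm_assoc, K.d_comp_d_assoc,
      zero_comp, comp_zero]

/-- Splitting an idempotent chain map which is homotopic to the identity, and equal to the
identity on the ends, does not change the relative homotopy class. -/
theorem Cpx.exists_split {n : ℕ} {A C : 𝒞} (X : Cpx n A C) (φ : X.K ⟶ X.K)
    (h : Homotopy φ (𝟙 X.K)) (h0 : φ.f 0 = 𝟙 _) (h1 : φ.f (n + 1) = 𝟙 _)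
    (Y : ℕ → 𝒞) (s : ∀ j, Y j ⟶ X.K.X j) (r : ∀ j, X.K.X j ⟶ Y j)
    (hsr : ∀ j, s j ≫ r j = 𝟙 _) (hrs : ∀ j, r j ≫ s j = φ.f j) :
    ∃ X' : Cpx n A C, Cpx.HoEquiv X X' ∧ X'.K.X = Y := by
  let K' := splitComplex φ Y s r hrs
  let R : X.K ⟶ K' :=
    { f := r
      comm' i j _ := by
        change r i ≫ s i ≫ X.K.d i j ≫ r j = X.K.d i j ≫ r j
        rw [reassoc_of% (hrs i), φ.comm_assoc, ← hrs j, Category.assoc, hsr, Category.comp_id] }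
  let T : K' ⟶ X.K :=
    { f := s
      comm' i j _ := by
        change s i ≫ X.K.d i j = (s i ≫ X.K.d i j ≫ r j) ≫ s j
        rw [Category.assoc, Category.assoc, hrs, ← φ.comm, ← hrs i, Category.assoc,
          reassoc_of% (hsr i)] }
  let X' : Cpx n A C :=
    { K := K'
      isZero_of_gt j hj := isZero_of_split_zero (by
        change 𝟙 (Y j) = 0
        rw [← hsr j, (X.isZero_of_gt j hj).eq_of_tgt (s j) 0, zero_comp])
      left := ⟨s 0, r 0, hsr 0, (hrs 0).trans h0⟩ ≪≫ X.left
      right := ⟨s (n + 1), r (n + 1), hsr _, (hrs _).trans h1⟩ ≪≫ X.right }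
  refine ⟨X', ⟨R, T, ⟨?_, ?_⟩, ⟨?_, ?_⟩, ⟨?_⟩, ⟨?_⟩⟩, rfl⟩
  · change r 0 ≫ s 0 ≫ X.left.hom = _
    rw [reassoc_of% (hrs 0), h0, Category.id_comp, Category.comp_id]
  · change r (n + 1) ≫ s (n + 1) ≫ X.right.hom = _
    rw [reassoc_of% (hrs (n + 1)), h1, Category.id_comp, Category.comp_id]
  · change s 0 ≫ X.left.hom = (s 0 ≫ X.left.hom) ≫ _
    rw [Category.comp_id]
  · change s (n + 1) ≫ X.right.hom = (s (n + 1) ≫ X.right.hom) ≫ _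
    rw [Category.comp_id]
  · exact (Homotopy.ofEq (by ext j; exact hrs j)).trans h
  · exact Homotopy.ofEq (by ext j; exact hsr j)

theorem up_rel (i : ℕ) : (ComplexShape.up ℕ).Rel i (i + 1) := rfl

/-- The null-homotopic endomorphism `dw + wd` of a complex given by `w : X_{i+1} ⟶ X_i`. -/
noncomputable def homotopyAt (K : CochainComplex 𝒞 ℕ) (i : ℕ) (w : K.X (i + 1) ⟶ K.X i)
    (a b : ℕ) (hab : (ComplexShape.up ℕ).Rel b a) : K.X a ⟶ K.X b :=
  if hb : b = i then
    (K.XIsoOfEq (show a = i + 1 by rw [← hb]; exact hab.symm)).hom ≫ w ≫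
      (K.XIsoOfEq hb.symm).hom
  else 0

theorem homotopyAt_self (K : CochainComplex 𝒞 ℕ) (i : ℕ) (w : K.X (i + 1) ⟶ K.X i)
    (h : (ComplexShape.up ℕ).Rel i (i + 1)) : homotopyAt K i w (i + 1) i h = w := by
  simp [homotopyAt]

theorem homotopyAt_of_ne (K : CochainComplex 𝒞 ℕ) (i : ℕ) (w : K.X (i + 1) ⟶ K.X i) (a b : ℕ)
    (h : (ComplexShape.up ℕ).Rel b a) (hb : b ≠ i) : homotopyAt K i w a b h = 0 := by
  simp [homotopyAt, hb]

theorem nullHomotopicMap_homotopyAt_self (K : CochainComplex 𝒞 ℕ) {i : ℕ} (hi : 1 ≤ i)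
    (w : K.X (i + 1) ⟶ K.X i) :
    (Homotopy.nullHomotopicMap' (homotopyAt K i w)).f i = K.d i (i + 1) ≫ w := by
  obtain ⟨i, rfl⟩ := Nat.exists_eq_add_of_le' hi
  rw [Homotopy.nullHomotopicMap'_f (k₂ := i) (k₀ := i + 1 + 1) (up_rel _) (up_rel _), homotopyAt_self,
    homotopyAt_of_ne _ _ _ _ _ _ (by omega), zero_comp, add_zero]

theorem nullHomotopicMap_homotopyAt_succ (K : CochainComplex 𝒞 ℕ) (i : ℕ)
    (w : K.X (i + 1) ⟶ K.X i) :
    (Homotopy.nullHomotopicMap' (homotopyAt K i w)).f (i + 1) = w ≫ K.d i (i + 1) := by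
  rw [Homotopy.nullHomotopicMap'_f (k₂ := i) (k₀ := i + 1 + 1) (up_rel _) (up_rel _), homotopyAt_self,
    homotopyAt_of_ne _ _ _ _ _ _ (by omega), comp_zero, zero_add]

theorem nullHomotopicMap_homotopyAt_of_ne (K : CochainComplex 𝒞 ℕ) (i : ℕ)
    (w : K.X (i + 1) ⟶ K.X i) (j : ℕ) (h : j ≠ i) (h' : j ≠ i + 1) :
    (Homotopy.nullHomotopicMap' (homotopyAt K i w)).f j = 0 := by
  rcases j with _ | j
  · rw [Homotopy.nullHomotopicMap'_f_of_not_rel_right (k₀ := 1) (up_rel 0) (by simp),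
      homotopyAt_of_ne _ _ _ _ _ _ h, comp_zero]
  · rw [Homotopy.nullHomotopicMap'_f (k₂ := j) (k₀ := j + 1 + 1) (up_rel _) (up_rel _),
      homotopyAt_of_ne _ _ _ _ _ _ (by omega), homotopyAt_of_ne _ _ _ _ _ _ (by omega), comp_zero,
      zero_comp, add_zero]

section Linear

variable {k : Type t} [Field k] [Linear k 𝒞]

/-- The linear map `f ↦ r f s` between endomorphism spaces induced by a retract. -/
def retractEnd (k : Type t) [Field k] [Linear k 𝒞] {X Y : 𝒞} (s : Y ⟶ X) (r : X ⟶ Y) :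
    (Y ⟶ Y) →ₗ[k] (X ⟶ X) :=
  Linear.leftComp k X r ∘ₗ Linear.rightComp k Y s

theorem retractEnd_injective {X Y : 𝒞} (s : Y ⟶ X) (r : X ⟶ Y) (h : s ≫ r = 𝟙 Y) :
    Function.Injective (retractEnd k s r) := by
  intro f g hfg
  have : r ≫ f ≫ s = r ≫ g ≫ s := hfg
  have h2 : s ≫ (r ≫ f ≫ s) ≫ r = s ≫ (r ≫ g ≫ s) ≫ r := by rw [this]
  simpa [reassoc_of% h, h] using h2

theorem finrank_end_le_of_retract [∀ X Y : 𝒞, Module.Finite k (X ⟶ Y)] {X Y : 𝒞} (s : Y ⟶ X)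
    (r : X ⟶ Y) (h : s ≫ r = 𝟙 Y) :
    Module.finrank k (Y ⟶ Y) ≤ Module.finrank k (X ⟶ X) :=
  LinearMap.finrank_le_finrank_of_injective (retractEnd_injective s r h)

theorem finrank_end_lt_of_retract [∀ X Y : 𝒞, Module.Finite k (X ⟶ Y)] {X Y : 𝒞} (s : Y ⟶ X)
    (r : X ⟶ Y) (h : s ≫ r = 𝟙 Y) (h' : r ≫ s ≠ 𝟙 X) :
    Module.finrank k (Y ⟶ Y) < Module.finrank k (X ⟶ X) := by
  rw [← LinearMap.finrank_range_of_inj (retractEnd_injective (k := k) s r h)]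
  -- If the range were everything, `𝟙 X` would factor as `r ≫ f ≫ s`, making `r ≫ s` the identity.
  refine Submodule.finrank_lt fun ht => h' ?_
  obtain ⟨f, hf⟩ : 𝟙 X ∈ LinearMap.range (retractEnd k s r) := by rw [ht]; trivial
  have hf : r ≫ f ≫ s = 𝟙 X := hf
  calc r ≫ s = r ≫ s ≫ (r ≫ f ≫ s) := by rw [hf, Category.comp_id]
    _ = r ≫ f ≫ s := by rw [reassoc_of% h]
    _ = 𝟙 X := hf

variable [HasFiniteBiproducts 𝒞]

/-- A complex with a non-radical inner differential is homotopy equivalent, relative to the ends,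
to a strictly smaller one. -/
theorem Cpx.exists_smaller [∀ X Y : 𝒞, Module.Finite k (X ⟶ Y)] (hKS : IsKrullSchmidt 𝒞) {n : ℕ}
    {A C : 𝒞} (X : Cpx n A C) (i : ℕ) (h1 : 1 ≤ i) (h2 : i + 1 ≤ n)
    (hd : ¬ InRad (X.K.d i (i + 1))) : ∃ X' : Cpx n A C, Cpx.HoEquiv X X' ∧
      ∑ j ∈ Finset.range (n + 2), Module.finrank k (X'.K.X j ⟶ X'.K.X j) <
        ∑ j ∈ Finset.range (n + 2), Module.finrank k (X.K.X j ⟶ X.K.X j) := by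
  obtain ⟨W, u, p, hW, hid, hP, hQ⟩ := hKS.exists_summand_of_not_inRad _ hd
  -- `N` is the null-homotopic idempotent onto the contractible summand `W = W` in degrees `i` and
  -- `i + 1`; `𝟙 - N` projects onto the rest.
  let N := Homotopy.nullHomotopicMap' (homotopyAt X.K i (p ≫ u))
  have hNi : N.f i = (X.K.d i (i + 1) ≫ p) ≫ u := by
    rw [Category.assoc]; exact nullHomotopicMap_homotopyAt_self _ h1 _
  have hNs : N.f (i + 1) = p ≫ u ≫ X.K.d i (i + 1) := by
    rw [← Category.assoc]; exact nullHomotopicMap_homotopyAt_succ _ _ _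
  have hN : ∀ j, j ≠ i → j ≠ i + 1 → N.f j = 0 := nullHomotopicMap_homotopyAt_of_ne _ _ _
  have hsplit : ∀ j, ∃ (Y : 𝒞) (s : Y ⟶ X.K.X j) (r : X.K.X j ⟶ Y),
      s ≫ r = 𝟙 Y ∧ r ≫ s = (𝟙 X.K - N).f j := by
    intro j
    rw [HomologicalComplex.sub_f_apply, HomologicalComplex.id_f]
    by_cases hj : j = i
    · subst hj; rw [hNi]; exact hP
    by_cases hj' : j = i + 1
    · subst hj'; rw [hNs]; exact hQ
    · exact ⟨_, 𝟙 _, 𝟙 _, by simp, by simp [hN j hj hj']⟩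
  choose Y s r hsr hrs using hsplit
  have hend : ∀ j, j ≠ i → j ≠ i + 1 → (𝟙 X.K - N).f j = 𝟙 _ := fun j hj hj' => by
    rw [HomologicalComplex.sub_f_apply, HomologicalComplex.id_f, hN j hj hj', sub_zero]
  have hhom : Homotopy (𝟙 X.K - N) (𝟙 X.K) :=
    (Homotopy.equivSubZero.symm ((Homotopy.ofEq (sub_sub_cancel _ _)).trans
      (Homotopy.nullHomotopy' _))).symm
  -- As `1 ≤ i` and `i + 1 ≤ n`, neither end degree is touched, so the equivalence is relative to
  -- the ends.
  obtain ⟨X', hX', hY⟩ := X.exists_split (𝟙 X.K - N) hhom (hend 0 (by omega) (by omega))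
    (hend (n + 1) (by omega) (by omega)) Y s r hsr hrs
  refine ⟨X', hX', ?_⟩
  rw [hY]
  refine Finset.sum_lt_sum (fun j _ => finrank_end_le_of_retract (s j) (r j) (hsr j))
    ⟨i, by simp; omega, finrank_end_lt_of_retract (s i) (r i) (hsr i) ?_⟩
  rw [hrs, HomologicalComplex.sub_f_apply, HomologicalComplex.id_f, hNi]
  intro h0
  rw [sub_eq_self] at h0
  refine hW (isZero_of_split_zero ?_)
  calc 𝟙 W = u ≫ ((X.K.d i (i + 1) ≫ p) ≫ u) ≫ X.K.d i (i + 1) ≫ p := by simp [hid]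
    _ = 0 := by rw [h0, zero_comp, comp_zero]

/-- Every homotopy class of complexes relative to the ends has a representative whose inner
differentials lie in the radical. -/
theorem Cpx.exists_radical (k : Type t) [Field k] [Linear k 𝒞]
    [∀ X Y : 𝒞, Module.Finite k (X ⟶ Y)] (hKS : IsKrullSchmidt 𝒞)
    {n : ℕ} {A C : 𝒞} (X : Cpx n A C) : ∃ X' : Cpx n A C, Cpx.HoEquiv X X' ∧
      ∀ i, 1 ≤ i → i + 1 ≤ n → InRad (X'.K.d i (i + 1)) := by
  obtain ⟨m, hm⟩ : ∃ m, m = ∑ j ∈ Finset.range (n + 2), Module.finrank k (X.K.X j ⟶ X.K.X j) :=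
    ⟨_, rfl⟩
  induction m using Nat.strong_induction_on generalizing X with
  | _ m ih =>
    by_cases h : ∀ i, 1 ≤ i → i + 1 ≤ n → InRad (X.K.d i (i + 1))
    · exact ⟨X, (Cpx.hoSetoid n A C).refl X, h⟩
    · push Not at h
      obtain ⟨i, h1, h2, hd⟩ := h
      obtain ⟨X', hX', hlt⟩ := X.exists_smaller (k := k) hKS i h1 h2 hd
      obtain ⟨X'', hX'', hr⟩ := ih _ (hm ▸ hlt) X' rfl
      exact ⟨X'', (Cpx.hoSetoid n A C).trans hX' hX'', hr⟩

end Linear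

end Minimal

/-! ### Functoriality and additivity of extensions -/

section Extensions

variable {𝒞 : Type u} [Category.{v} 𝒞] {E : 𝒞ᵒᵖ ⥤ 𝒞 ⥤ AddCommGrpCat.{w}}

theorem push_id {C A : 𝒞} (δ : Extn E C A) : push (𝟙 A) δ = δ := by simp [push]

theorem pull_id {C A : 𝒞} (δ : Extn E C A) : pull (𝟙 C) δ = δ := by simp [pull]

theorem push_comp {C A A' A'' : 𝒞} (a : A ⟶ A') (b : A' ⟶ A'') (δ : Extn E C A) :
    push (a ≫ b) δ = push b (push a δ) := by simp [push]

theorem pull_comp {C C' C'' A : 𝒞} (c : C'' ⟶ C') (d : C' ⟶ C) (δ : Extn E C A) :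
    pull (c ≫ d) δ = pull c (pull d δ) := by simp [pull]

theorem push_pull {C C' A A' : 𝒞} (a : A ⟶ A') (c : C' ⟶ C) (δ : Extn E C A) :
    push a (pull c δ) = pull c (push a δ) := by
  simp [push, pull]

@[simp] theorem push_zero {C A A' : 𝒞} (a : A ⟶ A') : push a (0 : Extn E C A) = 0 :=
  map_zero ((E.obj (op C)).map a).hom

@[simp] theorem pull_zero {C C' A : 𝒞} (c : C' ⟶ C) : pull c (0 : Extn E C A) = 0 :=
  map_zero ((E.map c.op).app A).hom

theorem push_add {C A A' : 𝒞} (a : A ⟶ A') (δ ρ : Extn E C A) :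
    push a (δ + ρ) = push a δ + push a ρ :=
  map_add ((E.obj (op C)).map a).hom δ ρ

theorem pull_add {C C' A : 𝒞} (c : C' ⟶ C) (δ ρ : Extn E C A) :
    pull c (δ + ρ) = pull c δ + pull c ρ :=
  map_add ((E.map c.op).app A).hom δ ρ

end Extensions

namespace PreExangulated

variable {𝒞 : Type u} [Category.{v} 𝒞] [Preadditive 𝒞] {n : ℕ} (S : PreExangulated.{w} n 𝒞)

/-- Pushing out a fixed extension, as an additive map. -/
def pushHom {C A : 𝒞} (δ : Extn S.E C A) (B : 𝒞) : (A ⟶ B) →+ Extn S.E C B where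
  toFun a := push a δ
  map_zero' := by
    have := S.additive_right (op C)
    simp [push]
  map_add' a b := by
    have := S.additive_right (op C)
    simp [push, Functor.map_add]

/-- Pulling back a fixed extension, as an additive map. -/
def pullHom {C A : 𝒞} (δ : Extn S.E C A) (D : 𝒞) : (D ⟶ C) →+ Extn S.E D A where
  toFun c := pull c δ
  map_zero' := by
    have := S.additive_left
    simp [pull]
  map_add' a b := by
    have := S.additive_left
    simp [pull, Functor.map_add]

theorem exists_dist {C A : 𝒞} (δ : Extn S.E C A) : ∃ X : Cpx n A C, S.Dist X δ := by
  obtain ⟨X, hX⟩ := Quotient.exists_rep (S.s δ)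
  exact ⟨X, hX.symm⟩

end PreExangulated

variable {𝒞 : Type u} [Category.{v} 𝒞] [Preadditive 𝒞] {n : ℕ} {S : PreExangulated.{w} n 𝒞}

theorem PreExangulated.zero_pull {C A D : 𝒞} (δ : Extn S.E C A) :
    pull (0 : D ⟶ C) δ = 0 := (S.pullHom δ D).map_zero

theorem PreExangulated.zero_push {C A B : 𝒞} (δ : Extn S.E C A) :
    push (0 : A ⟶ B) δ = 0 := (S.pushHom δ B).map_zero

theorem PreExangulated.add_pull {C A D : 𝒞} (c d : D ⟶ C) (δ : Extn S.E C A) :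
    pull (c + d) δ = pull c δ + pull d δ := (S.pullHom δ D).map_add c d

theorem PreExangulated.add_push {C A B : 𝒞} (a b : A ⟶ B) (δ : Extn S.E C A) :
    push (a + b) δ = push a δ + push b δ := (S.pushHom δ B).map_add a b

theorem PreExangulated.sub_pull {C A D : 𝒞} (c d : D ⟶ C) (δ : Extn S.E C A) :
    pull (c - d) δ = pull c δ - pull d δ := (S.pullHom δ D).map_sub c d

theorem PreExangulated.sub_push {C A B : 𝒞} (a b : A ⟶ B) (δ : Extn S.E C A) :
    push (a - b) δ = push a δ - push b δ := (S.pushHom δ B).map_sub a b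

/-- An extension fixed by pulling back along `c` with `1 - c` invertible vanishes. -/
theorem PreExangulated.eq_zero_of_pull_eq {C A : 𝒞} (δ : Extn S.E C A) (c : C ⟶ C)
    (hc : IsIso (𝟙 C - c)) (h : pull c δ = δ) : δ = 0 := by
  have h0 : pull (𝟙 C - c) δ = 0 := by rw [S.sub_pull, pull_id, h, sub_self]
  rw [← pull_id δ, ← IsIso.inv_hom_id (𝟙 C - c), pull_comp, h0, pull_zero]

theorem PreExangulated.eq_zero_of_push_eq {C A : 𝒞} (δ : Extn S.E C A) (a : A ⟶ A)
    (ha : IsIso (𝟙 A - a)) (h : push a δ = δ) : δ = 0 := by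
  have h0 : push (𝟙 A - a) δ = 0 := by rw [S.sub_push, push_id, h, sub_self]
  rw [← push_id δ, ← IsIso.hom_inv_id (𝟙 A - a), push_comp, h0, push_zero]

/-- The last map of an exangle with nonzero extension is not a split epimorphism. -/
theorem Cpx.IsExangle.not_isSplitEpi_last {C A : 𝒞} {X : Cpx n A C} {δ : Extn S.E C A}
    (hX : X.IsExangle δ) (hδ : δ ≠ 0) : ¬ IsSplitEpi X.last := fun ⟨⟨s⟩⟩ => hδ (by
  rw [← pull_id δ, ← s.id, pull_comp, hX.pull_last, pull_zero])

theorem Cpx.IsExangle.not_isSplitMono_first {C A : 𝒞} {X : Cpx n A C} {δ : Extn S.E C A}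
    (hX : X.IsExangle δ) (hδ : δ ≠ 0) : ¬ IsSplitMono X.first := fun ⟨⟨s⟩⟩ => hδ (by
  rw [← push_id δ, ← s.id, push_comp, hX.push_first, push_zero])

/-! ### One more exact term from the good lifts -/

section LongExact

variable [HasFiniteBiproducts 𝒞]

/-- Exactness of `𝒞(C, D) → E(C, A) → E(C, X₁)` for a distinguished `n`-exangle
`A ⟶ X₁ ⟶ ⋯ ⟶ D`. -/
theorem IsExangulated.exists_pull_eq (hS : IsExangulated S) (hn : 1 ≤ n) {A C D : 𝒞}
    {ρ : Extn S.E D A} {X : Cpx n A D} (hX : S.Dist X ρ) (θ : Extn S.E C A)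
    (h : push X.first θ = 0) : ∃ g : C ⟶ D, pull g ρ = θ := by
  -- `η` has components `ρ` and `θ`, so `X` realizes its restriction along `biprod.inl` and the good
  -- lift compares `X` with a realization of `η`.
  let η : Extn S.E (D ⊞ C) A :=
    pull (biprod.fst : D ⊞ C ⟶ D) ρ + pull (biprod.snd : D ⊞ C ⟶ C) θ
  have hl : pull (biprod.inl : D ⟶ D ⊞ C) η = ρ := by
    rw [pull_add, ← pull_comp, ← pull_comp, biprod.inl_fst, biprod.inl_snd, pull_id, S.zero_pull,
      add_zero]
  have hr : pull (biprod.inr : C ⟶ D ⊞ C) η = θ := by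
    rw [pull_add, ← pull_comp, ← pull_comp, biprod.inr_fst, biprod.inr_snd, pull_id, S.zero_pull,
      zero_add]
  obtain ⟨Z, hZ⟩ := S.exists_dist η
  obtain ⟨f, ⟨-, hf⟩, M, ⟨φ, -, -, hφ⟩, hM⟩ :=
    hS.good_lift η (biprod.inl : D ⟶ D ⊞ C) X Z (by rw [hl]; exact hX) hZ
  have h0 : push X.first η = 0 := by
    rw [push_add, push_pull, push_pull, (hS.isExangle ρ X hX).push_first, h, pull_zero,
      pull_zero, add_zero]
  -- The cone realizes the zero extension, so its last map splits. Composing the section with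
  -- `biprod.inr` writes `biprod.inr` as a map through `biprod.inl` plus one through `Z.last`;
  -- pulling `η` back kills the latter.
  rw [h0] at hM
  obtain ⟨t, ht⟩ := ((hS.isExangle _ M hM).exact_to_last (D ⊞ C) (𝟙 _)).1 (pull_zero _)
  have hlast : M.last = (φ n hn le_rfl).hom ≫
      biprod.desc (X.right.hom ≫ biprod.inl) Z.last := by
    rw [← hf, ← hφ hn, Iso.hom_inv_id_assoc]
  let q : C ⟶ X.K.X (n + 1) ⊞ Z.K.X n := biprod.inr ≫ t ≫ (φ n hn le_rfl).hom
  have hq : biprod.inr = (q ≫ biprod.fst ≫ X.right.hom) ≫ biprod.inl +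
      (q ≫ biprod.snd) ≫ Z.last := by
    calc biprod.inr = biprod.inr ≫ t ≫ M.last := by
          rw [show t ≫ M.last = 𝟙 _ from ht, Category.comp_id]
      _ = _ := by
          rw [hlast, biprod.desc_eq]
          simp only [q, Preadditive.comp_add, Category.assoc]
  refine ⟨q ≫ biprod.fst ≫ X.right.hom, ?_⟩
  rw [hq, S.add_pull, pull_comp _ biprod.inl, hl, pull_comp _ Z.last,
    (hS.isExangle η Z hZ).pull_last, pull_zero, add_zero] at hr
  exact hr

/-- Exactness of `𝒞(B, A) → E(C, A) → E(Xₙ, A)` for a distinguished `n`-exangle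
`B ⟶ ⋯ ⟶ Xₙ ⟶ C`. -/
theorem IsExangulated.exists_push_eq (hS : IsExangulated S) (hn : 1 ≤ n) {A B C : 𝒞}
    {ρ : Extn S.E C B} {X : Cpx n B C} (hX : S.Dist X ρ) (θ : Extn S.E C A)
    (h : pull X.last θ = 0) : ∃ b : B ⟶ A, push b ρ = θ := by
  let η : Extn S.E C (B ⊞ A) :=
    push (biprod.inl : B ⟶ B ⊞ A) ρ + push (biprod.inr : A ⟶ B ⊞ A) θ
  have hl : push (biprod.fst : B ⊞ A ⟶ B) η = ρ := by
    rw [push_add, ← push_comp, ← push_comp, biprod.inl_fst, biprod.inr_fst, push_id, S.zero_push,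
      add_zero]
  have hr : push (biprod.snd : B ⊞ A ⟶ A) η = θ := by
    rw [push_add, ← push_comp, ← push_comp, biprod.inl_snd, biprod.inr_snd, push_id, S.zero_push,
      zero_add]
  obtain ⟨Z, hZ⟩ := S.exists_dist η
  obtain ⟨f, ⟨hf, -⟩, N, ⟨ψ, hψ, -, -⟩, hN⟩ :=
    hS.good_lift_op η (biprod.fst : B ⊞ A ⟶ B) Z X hZ (by rw [hl]; exact hX)
  have h0 : pull X.last η = 0 := by
    rw [pull_add, ← push_pull, ← push_pull, (hS.isExangle ρ X hX).pull_last, h, push_zero,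
      push_zero, add_zero]
  rw [h0] at hN
  -- The cocone realizes zero, so its first map has a retraction `t`; this writes `biprod.snd` as a
  -- map through `biprod.fst` plus one through `Z.first`.
  obtain ⟨t, ht⟩ := ((hS.isExangle _ N hN).exact_from_first (B ⊞ A) (𝟙 _)).1 (push_zero _)
  have hf' : Z.left.inv ≫ f.f 0 = biprod.fst ≫ X.left.inv := by
    rw [Iso.inv_comp_eq, ← Category.assoc, ← hf, Category.assoc, Iso.hom_inv_id,
      Category.comp_id]
  have hfirst : N.first =
      biprod.lift (biprod.fst ≫ X.left.inv) Z.first ≫ (ψ 0 1 rfl hn).inv := by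
    rw [← hf', ← hψ hn, Category.assoc, Iso.hom_inv_id, Category.comp_id]
  let q : X.K.X 0 ⊞ Z.K.X 1 ⟶ A := (ψ 0 1 rfl hn).inv ≫ t ≫ biprod.snd
  have hq : biprod.snd = biprod.fst ≫ (X.left.inv ≫ biprod.inl ≫ q) +
      Z.first ≫ (biprod.inr ≫ q) := by
    calc biprod.snd = (N.first ≫ t) ≫ biprod.snd := by
          rw [show N.first ≫ t = 𝟙 _ from ht, Category.id_comp]
      _ = _ := by
          rw [hfirst, biprod.lift_eq]
          simp only [q, Preadditive.add_comp, Category.assoc]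
  refine ⟨X.left.inv ≫ biprod.inl ≫ q, ?_⟩
  rw [hq, S.add_push, push_comp biprod.fst, hl, push_comp Z.first,
    (hS.isExangle η Z hZ).push_first, push_zero, add_zero] at hr
  exact hr

end LongExact

/-! ### Socle elements and almost split extensions -/

section Socle

/-- Every morphism into `C` that is not a split epimorphism annihilates `δ ∈ E(C, A)`. -/
def RightSocle {C A : 𝒞} (δ : Extn S.E C A) : Prop :=
  ∀ ⦃Y : 𝒞⦄ (f : Y ⟶ C), ¬ IsSplitEpi f → pull f δ = 0

/-- Every morphism out of `A` that is not a split monomorphism annihilates `δ ∈ E(C, A)`. -/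
def LeftSocle {C A : 𝒞} (δ : Extn S.E C A) : Prop :=
  ∀ ⦃Y : 𝒞⦄ (a : A ⟶ Y), ¬ IsSplitMono a → push a δ = 0

variable [HasFiniteBiproducts 𝒞]

/-- Suppose `push a δ ≠ 0` with `a` not a split monomorphism. The last map of its realization is not
a split epimorphism, hence kills `δ`, so `δ` is a push of `push a δ`. Thus `δ` is fixed by some `a ≫
b`, impossible since `A` is local. -/
theorem IsExangulated.leftSocle_of_rightSocle (hS : IsExangulated S) (hn : 1 ≤ n) {A C : 𝒞}
    (hA : LocalObject A) {δ : Extn S.E C A} (hδ : δ ≠ 0) (h : RightSocle δ) : LeftSocle δ := by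
  intro Y a ha
  by_contra hne
  obtain ⟨X, hX⟩ := S.exists_dist (push a δ)
  obtain ⟨b, hb⟩ := hS.exists_push_eq hn hX δ
    (h _ ((hS.isExangle _ X hX).not_isSplitEpi_last hne))
  rw [← push_comp] at hb
  exact hδ (S.eq_zero_of_push_eq δ _ (hA.isIso_sub_of_not_splitMono a ha b) hb)

theorem IsExangulated.rightSocle_of_leftSocle (hS : IsExangulated S) (hn : 1 ≤ n) {A C : 𝒞}
    (hC : LocalObject C) {δ : Extn S.E C A} (hδ : δ ≠ 0) (h : LeftSocle δ) : RightSocle δ := by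
  intro Y c hc
  by_contra hne
  obtain ⟨X, hX⟩ := S.exists_dist (pull c δ)
  obtain ⟨g, hg⟩ := hS.exists_pull_eq hn hX δ
    (h _ ((hS.isExangle _ X hX).not_isSplitMono_first hne))
  rw [← pull_comp] at hg
  exact hδ (S.eq_zero_of_pull_eq δ _ (hC.isIso_sub_of_not_splitEpi c hc g) hg)

/-- An extension which is annihilated by the radical on both sides is realized by an
Auslander–Reiten `n`-exangle. -/
theorem IsExangulated.exists_isARExangle (k : Type t) [Field k] [Linear k 𝒞]
    [∀ X Y : 𝒞, Module.Finite k (X ⟶ Y)] (hKS : IsKrullSchmidt 𝒞) (hS : IsExangulated S)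
    {A C : 𝒞} {δ : Extn S.E C A} (hδ : δ ≠ 0) (hr : RightSocle δ) (hl : LeftSocle δ) :
    ∃ K : Cpx n A C, IsARExangle S K δ := by
  obtain ⟨X, hX⟩ := S.exists_dist δ
  obtain ⟨X', hXX', hrad⟩ := Cpx.exists_radical k hKS X
  have hX' : S.Dist X' δ := Eq.trans hX (Quotient.sound hXX')
  have hex := hS.isExangle δ X' hX'
  exact ⟨X', hX', ⟨hex.not_isSplitMono_first hδ,
      fun Y g hg => (hex.exact_from_first Y g).1 (hl g hg)⟩,
    ⟨hex.not_isSplitEpi_last hδ, fun Y g hg => (hex.exact_to_last Y g).1 (hr g hg)⟩, hrad⟩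

/-- Supplies the local first term needed by `leftSocle_of_rightSocle`: some component of `δ`
survives, and pushing commutes with pulling, so it stays in the socle. -/
theorem exists_localObject_rightSocle (hKS : IsKrullSchmidt 𝒞) {A C : 𝒞} {δ : Extn S.E C A}
    (hδ : δ ≠ 0) (h : RightSocle δ) :
    ∃ (B : 𝒞) (ρ : Extn S.E C B), LocalObject B ∧ ρ ≠ 0 ∧ RightSocle ρ := by
  obtain ⟨m, Y, ι, π, hY, htot, -⟩ := hKS.exists_decomposition A
  have : ∃ i, push (π i) δ ≠ 0 := by
    by_contra! hc
    apply hδ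
    calc δ = S.pushHom δ A (∑ i, π i ≫ ι i) := by rw [htot]; exact (push_id δ).symm
      _ = ∑ i, push (π i ≫ ι i) δ := map_sum _ _ _
      _ = 0 := Finset.sum_eq_zero fun i _ => by rw [push_comp, hc, push_zero]
  obtain ⟨i, hi⟩ := this
  exact ⟨Y i, push (π i) δ, hY i, hi, fun Z f hf => by rw [← push_pull, h f hf, push_zero]⟩

theorem exists_localObject_leftSocle (hKS : IsKrullSchmidt 𝒞) {A C : 𝒞} {δ : Extn S.E C A}
    (hδ : δ ≠ 0) (h : LeftSocle δ) :
    ∃ (D : 𝒞) (ρ : Extn S.E D A), LocalObject D ∧ ρ ≠ 0 ∧ LeftSocle ρ := by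
  obtain ⟨m, Y, ι, π, hY, htot, -⟩ := hKS.exists_decomposition C
  have : ∃ i, pull (ι i) δ ≠ 0 := by
    by_contra! hc
    apply hδ
    calc δ = S.pullHom δ C (∑ i, π i ≫ ι i) := by rw [htot]; exact (pull_id δ).symm
      _ = ∑ i, pull (π i ≫ ι i) δ := map_sum _ _ _
      _ = 0 := Finset.sum_eq_zero fun i _ => by rw [pull_comp, hc, pull_zero]
  obtain ⟨i, hi⟩ := this
  exact ⟨Y i, pull (ι i) δ, hY i, hi, fun Z f hf => by rw [push_pull, h f hf, pull_zero]⟩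

/-- A single object detects the vanishing of all pullbacks of extensions in `E(C, -)`. -/
theorem exists_detecting_pull (S : PreExangulated.{w} n 𝒞) (hKS : IsKrullSchmidt 𝒞)
    (hlf : IsLocallyFinite 𝒞) {C : 𝒞} (hC : Indecomposable C) :
    ∃ T : 𝒞, ∀ ⦃Y A : 𝒞⦄ (f : Y ⟶ C) (δ : Extn S.E C A), pull f δ ≠ 0 →
      ∃ t : T ⟶ Y, pull (t ≫ f) δ ≠ 0 := by
  obtain ⟨T, hT⟩ := exists_object_with_summands _ (hlf C hC).2
  refine ⟨T, fun Y A f δ hf => ?_⟩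
  obtain ⟨m, Z, ι, π, hZ, htot, -⟩ := hKS.exists_decomposition Y
  have : ∃ i, pull (ι i ≫ f) δ ≠ 0 := by
    by_contra! hc
    apply hf
    calc pull f δ = S.pullHom δ Y (∑ i, π i ≫ ι i ≫ f) := by
          simp only [← Category.assoc, ← Preadditive.sum_comp]
          rw [htot, Category.id_comp]; rfl
      _ = ∑ i, pull (π i ≫ ι i ≫ f) δ := map_sum _ _ _
      _ = 0 := Finset.sum_eq_zero fun i _ => by rw [pull_comp, hc, pull_zero]
  obtain ⟨i, hi⟩ := this
  -- The local summand `Z i` maps nontrivially to `C`, so it is one of the finitely many classes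
  -- that are summands of `T`.
  obtain ⟨j, r, hjr⟩ := hT (Z i) ⟨(hZ i).indecomposable, ι i ≫ f, fun h0 => hi (by
    rw [h0, S.zero_pull])⟩
  refine ⟨r ≫ ι i, fun h0 => hi ?_⟩
  rw [← Category.id_comp (ι i ≫ f), ← hjr, Category.assoc, ← Category.assoc r, pull_comp, h0,
    pull_zero]

/-- A single object detects the vanishing of all pushouts of extensions in `E(-, A)`. -/
theorem exists_detecting_push (S : PreExangulated.{w} n 𝒞) (hKS : IsKrullSchmidt 𝒞)
    (hlf : IsLocallyFinite 𝒞) {A : 𝒞} (hA : Indecomposable A) :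
    ∃ T : 𝒞, ∀ ⦃Y C : 𝒞⦄ (f : A ⟶ Y) (δ : Extn S.E C A), push f δ ≠ 0 →
      ∃ t : Y ⟶ T, push (f ≫ t) δ ≠ 0 := by
  obtain ⟨T, hT⟩ := exists_object_with_summands _ (hlf A hA).1
  refine ⟨T, fun Y C f δ hf => ?_⟩
  obtain ⟨m, Z, ι, π, hZ, htot, -⟩ := hKS.exists_decomposition Y
  have : ∃ i, push (f ≫ π i) δ ≠ 0 := by
    by_contra! hc
    apply hf
    calc push f δ = S.pushHom δ Y (∑ i, (f ≫ π i) ≫ ι i) := by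
          simp only [Category.assoc, ← Preadditive.comp_sum]
          rw [htot, Category.comp_id]; rfl
      _ = ∑ i, push ((f ≫ π i) ≫ ι i) δ := map_sum _ _ _
      _ = 0 := Finset.sum_eq_zero fun i _ => by rw [push_comp, hc, push_zero]
  obtain ⟨i, hi⟩ := this
  obtain ⟨j, r, hjr⟩ := hT (Z i) ⟨(hZ i).indecomposable, f ≫ π i, fun h0 => hi (by
    rw [h0, S.zero_push])⟩
  refine ⟨π i ≫ j, fun h0 => hi ?_⟩
  rw [← Category.comp_id (f ≫ π i), ← hjr, ← Category.assoc, Category.assoc f, push_comp, h0,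
    push_zero]

section Annihilators

variable (k : Type t) [Field k] [Linear k 𝒞]

/-- The subspace of morphisms along which the pullback of `δ` vanishes. -/
def pullAnnihilator {C A : 𝒞} (δ : Extn S.E C A) (T : 𝒞) : Submodule k (T ⟶ C) where
  carrier := {f | pull f δ = 0}
  zero_mem' := S.zero_pull δ
  add_mem' {f g} hf hg := by
    change pull (f + g) δ = 0
    rw [S.add_pull, show pull f δ = 0 from hf, show pull g δ = 0 from hg, add_zero]
  smul_mem' c f hf := by
    change pull (c • f) δ = 0
    -- `E` carries no `k`-structure; the scalar acts through the endomorphism `c • 𝟙`.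
    rw [← Category.id_comp f, ← Linear.smul_comp, pull_comp, show pull f δ = 0 from hf, pull_zero]

/-- The subspace of morphisms along which the pushout of `δ` vanishes. -/
def pushAnnihilator {C A : 𝒞} (δ : Extn S.E C A) (T : 𝒞) : Submodule k (A ⟶ T) where
  carrier := {f | push f δ = 0}
  zero_mem' := S.zero_push δ
  add_mem' {f g} hf hg := by
    change push (f + g) δ = 0
    rw [S.add_push, show push f δ = 0 from hf, show push g δ = 0 from hg, add_zero]
  smul_mem' c f hf := by
    change push (c • f) δ = 0
    rw [← Category.comp_id f, ← Linear.comp_smul, push_comp, show push f δ = 0 from hf, push_zero]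

end Annihilators

/-- Maximality of the annihilator plays the role of a socle argument for the functor `E(C, -)`; the
ascending chain condition comes from finite-dimensionality of `T ⟶ C`. -/
theorem IsExangulated.exists_rightSocle (k : Type t) [Field k] [Linear k 𝒞]
    [∀ X Y : 𝒞, Module.Finite k (X ⟶ Y)] (hKS : IsKrullSchmidt 𝒞) (hlf : IsLocallyFinite 𝒞)
    (hS : IsExangulated S) (hn : 1 ≤ n) {A C : 𝒞} (hC : Indecomposable C) (δ₀ : Extn S.E C A)
    (hδ₀ : δ₀ ≠ 0) : ∃ (B : 𝒞) (δ : Extn S.E C B), δ ≠ 0 ∧ RightSocle δ := by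
  obtain ⟨T, hT⟩ := exists_detecting_pull S hKS hlf hC
  obtain ⟨V, ⟨B, δ, hδ, rfl⟩, hmax⟩ := (wellFounded_gt (α := Submodule k (T ⟶ C))).has_min
    {V | ∃ (B : 𝒞) (δ : Extn S.E C B), δ ≠ 0 ∧ pullAnnihilator k δ T = V}
    ⟨_, A, δ₀, hδ₀, rfl⟩
  refine ⟨B, δ, hδ, fun Y f hf => ?_⟩
  by_contra hne
  obtain ⟨X, hX⟩ := S.exists_dist (pull f δ)
  have hpush : push X.first δ ≠ 0 := fun h0 => by
    obtain ⟨g, hg⟩ := hS.exists_pull_eq hn hX δ h0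
    rw [← pull_comp] at hg
    exact hδ (S.eq_zero_of_pull_eq δ _
      ((hKS.localObject hC).isIso_sub_of_not_splitEpi f hf g) hg)
  obtain ⟨t, ht⟩ := hT f δ hne
  -- Pushing can only enlarge the annihilator, and `t ≫ f` is new in it: `X.first` kills `pull f δ`,
  -- yet `pull (t ≫ f) δ ≠ 0`.
  refine hmax _ ⟨_, push X.first δ, hpush, rfl⟩ (SetLike.lt_iff_le_and_exists.2 ⟨?_, t ≫ f, ?_, ht⟩)
  · intro g hg
    change pull g (push X.first δ) = 0
    rw [← push_pull, show pull g δ = 0 from hg, push_zero]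
  · change pull (t ≫ f) (push X.first δ) = 0
    rw [pull_comp, ← push_pull, (hS.isExangle _ X hX).push_first, pull_zero]

theorem IsExangulated.exists_leftSocle (k : Type t) [Field k] [Linear k 𝒞]
    [∀ X Y : 𝒞, Module.Finite k (X ⟶ Y)] (hKS : IsKrullSchmidt 𝒞) (hlf : IsLocallyFinite 𝒞)
    (hS : IsExangulated S) (hn : 1 ≤ n) {A C : 𝒞} (hA : Indecomposable A) (δ₀ : Extn S.E C A)
    (hδ₀ : δ₀ ≠ 0) : ∃ (D : 𝒞) (δ : Extn S.E D A), δ ≠ 0 ∧ LeftSocle δ := by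
  obtain ⟨T, hT⟩ := exists_detecting_push S hKS hlf hA
  obtain ⟨V, ⟨D, δ, hδ, rfl⟩, hmax⟩ := (wellFounded_gt (α := Submodule k (A ⟶ T))).has_min
    {V | ∃ (D : 𝒞) (δ : Extn S.E D A), δ ≠ 0 ∧ pushAnnihilator k δ T = V}
    ⟨_, C, δ₀, hδ₀, rfl⟩
  refine ⟨D, δ, hδ, fun Y f hf => ?_⟩
  by_contra hne
  obtain ⟨X, hX⟩ := S.exists_dist (push f δ)
  -- Otherwise `δ` would be fixed by pushing along `f ≫ g`, which is impossible since `A` is local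
  -- and `f` is not a split monomorphism.
  have hpull : pull X.last δ ≠ 0 := fun h0 => by
    obtain ⟨g, hg⟩ := hS.exists_push_eq hn hX δ h0
    rw [← push_comp] at hg
    exact hδ (S.eq_zero_of_push_eq δ _
      ((hKS.localObject hA).isIso_sub_of_not_splitMono f hf g) hg)
  obtain ⟨t, ht⟩ := hT f δ hne
  refine hmax _ ⟨_, pull X.last δ, hpull, rfl⟩ (SetLike.lt_iff_le_and_exists.2 ⟨?_, f ≫ t, ?_, ht⟩)
  · intro g hg
    change push g (pull X.last δ) = 0
    rw [push_pull, show push g δ = 0 from hg, pull_zero]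
  · change push (f ≫ t) (pull X.last δ) = 0
    rw [push_comp, push_pull, (hS.isExangle _ X hX).pull_last, push_zero]

/-- If all extensions ending at `P` vanish, every pullback to `P` is zero, and exactness at the last
term yields the required factorizations. -/
theorem IsExangulated.exists_ne_zero_of_not_projective (hS : IsExangulated S) {P : 𝒞}
    (hP : ¬ S.Projective P) : ∃ (A : 𝒞) (δ : Extn S.E P A), δ ≠ 0 := by
  by_contra! h
  exact hP fun A C X δ hX c => ((hS.isExangle δ X hX).exact_to_last P c).1 (h A _)

theorem IsExangulated.exists_ne_zero_of_not_injective (hS : IsExangulated S) {I : 𝒞}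
    (hI : ¬ S.Injective I) : ∃ (C : 𝒞) (δ : Extn S.E C I), δ ≠ 0 := by
  by_contra! h
  exact hI fun A C X δ hX a => ((hS.isExangle δ X hX).exact_from_first I a).1 (h C _)

end Socle

end NExang

theorem theorem3p10
    {k : Type t} [Field k]
    {𝒞 : Type u} [Category.{v} 𝒞] [Preadditive 𝒞] [HasFiniteBiproducts 𝒞] [Linear k 𝒞]
    (homFinite : ∀ X Y : 𝒞, Module.Finite k (X ⟶ Y))
    (krullSchmidt : NExang.IsKrullSchmidt 𝒞)
    (n : ℕ) (hn : 1 ≤ n)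
    (S : NExang.PreExangulated.{w} n 𝒞) (hS : NExang.IsExangulated S)
    (locallyFinite : NExang.IsLocallyFinite 𝒞) :
    (∀ X : 𝒞, Indecomposable X → ¬ S.Projective X →
      ∃ (A : 𝒞) (δ : NExang.Extn S.E X A) (K : NExang.Cpx n A X), NExang.IsARExangle S K δ) ∧
    (∀ Y : 𝒞, Indecomposable Y → ¬ S.Injective Y →
      ∃ (C : 𝒞) (δ : NExang.Extn S.E C Y) (K : NExang.Cpx n Y C), NExang.IsARExangle S K δ) := by
  refine ⟨fun X hX hP => ?_, fun Y hY hI => ?_⟩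
  · obtain ⟨A₀, δ₀, hδ₀⟩ := hS.exists_ne_zero_of_not_projective hP
    obtain ⟨A₁, δ₁, hδ₁, hr₁⟩ :=
      hS.exists_rightSocle k krullSchmidt locallyFinite hn hX δ₀ hδ₀
    obtain ⟨A, δ, hA, hδ, hr⟩ := NExang.exists_localObject_rightSocle krullSchmidt hδ₁ hr₁
    exact ⟨A, δ, hS.exists_isARExangle k krullSchmidt hδ hr
      (hS.leftSocle_of_rightSocle hn hA hδ hr)⟩
  · obtain ⟨C₀, δ₀, hδ₀⟩ := hS.exists_ne_zero_of_not_injective hI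
    obtain ⟨C₁, δ₁, hδ₁, hl₁⟩ :=
      hS.exists_leftSocle k krullSchmidt locallyFinite hn hY δ₀ hδ₀
    obtain ⟨C, δ, hC, hδ, hl⟩ := NExang.exists_localObject_leftSocle krullSchmidt hδ₁ hl₁
    exact ⟨C, δ, hS.exists_isARExangle k krullSchmidt hδ
      (hS.rightSocle_of_leftSocle hn hC hδ hl) hl⟩
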